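/- Let $\mathcal C$ be a triangulated category and let $\mathcal D=(\mathcal D^{\le0},\mathcal D^{\ge0})$, $\mathcal T=(\mathcal T^{\le0},\mathcal T^{\ge0})$ be $t$-structures on $\mathcal C$, with $\mathcal D$ non-degenerate, i.e. $\bigcap_m\mathcal D^{\le m}=0=\bigcap_m\mathcal D^{\ge m}$ (all full subcategories are strictly full; $\mathcal D^{\le m}=\mathcal D^{\le 0}[-m]$, $\mathcal D^{\ge m}=\mathcal D^{\ge 0}[-m]$). Let $n\in\mathbb N$ and suppose that: (a) $(\mathcal D,\mathcal T)$ is right filterable: for every $i\in\mathbb Z$ the intersection $\mathcal D^{\ge i}\cap\mathcal T^{\ge 0}$ is a co-aisle, that is, equals $\mathcal E^{\ge0}$ for some $t$-structure $\mathcal E$ on $\mathcal C$; (b) $(\mathcal D,\mathcal T)$ is of type $(n,0)$: $k=0$ is the greatest integer $k$ with $\mathcal T^{\le k}\subseteq\mathcal D^{\le0}$, and $n$ is the least natural number with $\mathcal D^{\le -n}\subseteq\mathcal T^{\le 0}$. For a $t$-structure $\mathcal E$ with heart $\mathcal H_{\mathcal E}=\mathcal E^{\le0}\cap\mathcal E^{\ge0}$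 and cohomology functors $H^i_{\mathcal E}:\mathcal C\to\mathcal H_{\mathcal E}$, $H^i_{\mathcal E}(C)=\varepsilon^{\ge0}\varepsilon^{\le0}(C[i])$, where $\varepsilon^{\le0},\varepsilon^{\ge0}$ are the truncation functors of $\mathcal E$, and for a torsion pair $(\mathcal X,\mathcal Y)$ in the abelian category $\mathcal H_{\mathcal E}$ (so $\operatorname{Hom}(\mathcal X,\mathcal Y)=0$, and every object $C$ of $\mathcal H_{\mathcal E}$ has a short exact sequence $0\to X\to C\to Y\to0$ with $X\in\mathcal X$, $Y\in\mathcal Y$), a $t$-structure $\mathcal E'$ is said to be obtained by tilting $\mathcal E$ with respect to $(\mathcal X,\mathcal Y)$ (the HRS tilt) if $$\mathcal E'^{\le0}=\{C: H^0_{\mathcal E}(C)\in\mathcal X,\ H^i_{\mathcal E}(C)=0\ \forall i>0\},\qquad \mathcal E'^{\ge0}=\{C: H^{-1}_{\mathcal E}(C)\in\mathcal Y,\ H^i_{\mathcal E}(C)=0\ \forall i<-1\}.$$ For $i\in\mathbb Z$ let $\mathcal D_i$ (the $i$-th right basic $t$-structure) be the unique $t$-structure with co-aisle $\mathcal D_i^{\ge0}=\mathcal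 D^{\ge -i}\cap\mathcal T^{\ge0}$, and let $\mathcal H_i$ be its heart. Then $\mathcal T$ is obtained from $\mathcal D$ by an iterated HRS procedure of length $n$, that is, there are non-degenerate $t$-structures $\mathcal D=\mathcal E_0,\mathcal E_1,\dots,\mathcal E_n=\mathcal T$ such that, for $0\le i<n$, $\mathcal E_{i+1}$ is obtained by tilting $\mathcal E_i$ with respect to a torsion pair in the heart of $\mathcal E_i$. More precisely, one can take $\mathcal E_i=\mathcal D_i$: one has $\mathcal D_0=\mathcal D$ and $\mathcal D_n=\mathcal T$, the $\mathcal D_i$ with $0\le i\le n$ are non-degenerate, and for $0\le i<n$ the pair $$(\mathcal X_i,\mathcal Y_i)=(\mathcal D_{i+1}^{\le0}\cap\mathcal H_i,\ \mathcal D_{i+1}^{\ge1}\cap\mathcal H_i)$$ is a torsion pair in $\mathcal H_i$ and $\mathcal D_{i+1}$ is obtained by tilting $\mathcal D_i$ with respect to $(\mathcal X_i,\mathcal Y_i)$. -/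

import Mathlib

open CategoryTheory CategoryTheory.Limits CategoryTheory.Triangulated

universe v u

/-- A torsion pair `(X, Y)` in an abelian category `A`: two strictly full subcategories with
`Hom(X, Y) = 0` such that every object `E` sits in a short exact sequence `0 → X → E → Y → 0`.
Only the (pre)additive structure of `A` enters the definition, so that it applies verbatim to the
full subcategory of heart objects of a t-structure. (Any such `X` is the left orthogonal of `Y` and
`Y` is the right orthogonal of `X`, so both classes are automatically additive.) -/
structure IsTorsionPair {A : Type u} [Category.{v} A] [Preadditive A]
    (X Y : ObjectProperty A) : Prop where
  isoClosed_left : X.IsClosedUnderIsomorphisms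
  isoClosed_right : Y.IsClosedUnderIsomorphisms
  hom_eq_zero : ∀ ⦃M N : A⦄, X M → Y N → ∀ f : M ⟶ N, f = 0
  exists_shortExact : ∀ E : A, ∃ S : ShortComplex A,
    S.ShortExact ∧ X S.X₁ ∧ S.X₂ = E ∧ Y S.X₃

namespace CategoryTheory.Triangulated.TStructure

section

variable {C : Type u} [Category.{v} C] [Preadditive C] [HasZeroObject C] [HasShift C ℤ]
  [∀ n : ℤ, (shiftFunctor C n).Additive] [Pretriangulated C]

/-- `⋂ D^{≤ n} = 0` and `⋂ D^{≥ n} = 0`. -/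
structure IsNonDegenerate (D : TStructure C) : Prop where
  isZero_of_forall_le : ∀ M : C, (∀ n : ℤ, D.le n M) → IsZero M
  isZero_of_forall_ge : ∀ M : C, (∀ n : ℤ, D.ge n M) → IsZero M

/-- A full subcategory is a co-aisle if it is the class `E^{≥ 0}` of some t-structure `E`. -/
def IsCoaisle (P : ObjectProperty C) : Prop :=
  ∃ E : TStructure C, E.ge 0 = P

/-- The pair `(D, T)` is right filterable if `D^{≥ i} ∩ T^{≥ 0}` is a co-aisle for every `i : ℤ`. -/
def IsRightFilterable (D T : TStructure C) : Prop :=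
  ∀ i : ℤ, IsCoaisle (D.ge i ⊓ T.ge 0)

/-- The pair `(D, T)` is of type `(n, k)` (gap `n` and shift `k`): `k` is the greatest integer with
`T^{≤ k} ⊆ D^{≤ 0}` and `n` is the least natural number with `D^{≤ -n} ⊆ T^{≤ k}`. -/
def IsOfType (D T : TStructure C) (n : ℕ) (k : ℤ) : Prop :=
  IsGreatest {j : ℤ | T.le j ≤ D.le 0} k ∧
    IsLeast {m : ℕ | D.le (-(m : ℤ)) ≤ T.le k} n

/-- A t-structure is determined by its co-aisle. -/
theorem eq_of_ge_zero_eq (D E : TStructure C) (h : D.ge 0 = E.ge 0) : D = E := by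
  have hge : D.ge = E.ge := by
    funext n
    rw [← D.shift_ge n 0 n (by simp), ← E.shift_ge n 0 n (by simp), h]
  have hle : D.le = E.le := by
    funext n
    ext M
    rw [le_iff_isLE, le_iff_isLE, D.isLE_iff_orthogonal n (n + 1) rfl,
      E.isLE_iff_orthogonal n (n + 1) rfl]
    have key : ∀ Y : C, D.IsGE Y (n + 1) ↔ E.IsGE Y (n + 1) := fun Y ↦ by
      rw [← ge_iff_isGE, ← ge_iff_isGE, hge]
    simp only [key]
  cases D
  cases E
  simp_all

/-- The right basic t-structure `D_i` of a right filterable pair `(D, T)`: the (unique) t-structure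
whose co-aisle is `D^{≥ -i} ∩ T^{≥ 0}`. -/
noncomputable def rightBasic {D T : TStructure C} (h : IsRightFilterable D T) (i : ℤ) :
    TStructure C :=
  (h (-i)).choose

theorem rightBasic_ge_zero {D T : TStructure C} (h : IsRightFilterable D T) (i : ℤ) :
    (rightBasic h i).ge 0 = D.ge (-i) ⊓ T.ge 0 :=
  (h (-i)).choose_spec

/-- The right basic torsion class `X_i = D_{i+1}^{≤ 0} ∩ H_i` in the heart `H_i` of `D_i`. -/
def rightBasicTorsion {D T : TStructure C} (h : IsRightFilterable D T) (i : ℤ) :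
    ObjectProperty (rightBasic h i).heart.FullSubcategory :=
  ((rightBasic h (i + 1)).le 0).inverseImage (rightBasic h i).heart.ι

/-- The right basic torsion-free class `Y_i = D_{i+1}^{≥ 1} ∩ H_i` in the heart `H_i` of `D_i`. -/
def rightBasicTorsionFree {D T : TStructure C} (h : IsRightFilterable D T) (i : ℤ) :
    ObjectProperty (rightBasic h i).heart.FullSubcategory :=
  ((rightBasic h (i + 1)).ge 1).inverseImage (rightBasic h i).heart.ι

variable [IsTriangulated C]

/-- The `i`-th t-cohomology `H^i_D(M) = δ^{≥ 0} δ^{≤ 0} (M[i])`, as an object of the heart. -/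
noncomputable def cohomology (D : TStructure C) (i : ℤ) (M : C) : D.heart.FullSubcategory where
  obj := (D.truncGELE 0 0).obj (M⟦i⟧)
  property := (D.mem_heart_iff _).2 ⟨inferInstance, inferInstance⟩

/-- `T` is obtained by tilting `D` with respect to the torsion pair `(X, Y)` in the heart of `D`
(Happel-Reiten-Smalø). -/
structure IsTilt (D T : TStructure C) (X Y : ObjectProperty D.heart.FullSubcategory) : Prop where
  isTorsionPair : IsTorsionPair X Y
  le_zero_iff : ∀ M : C,
    T.le 0 M ↔ X (D.cohomology 0 M) ∧ ∀ i : ℤ, 0 < i → IsZero (D.cohomology i M)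
  ge_zero_iff : ∀ M : C,
    T.ge 0 M ↔ Y (D.cohomology (-1) M) ∧ ∀ i : ℤ, i < -1 → IsZero (D.cohomology i M)

/-- `T` is obtained from `D` by an iterated HRS procedure of length `m`: there are (non-degenerate)
t-structures `D = E_0, E_1, …, E_m = T` such that each `E_{i+1}` is obtained by tilting `E_i` with
respect to a torsion pair in the heart of `E_i`. -/
def IsIteratedHRS (D T : TStructure C) (m : ℕ) : Prop :=
  ∃ E : ℕ → TStructure C, E 0 = D ∧ E m = T ∧ (∀ i ≤ m, (E i).IsNonDegenerate) ∧
    ∀ i < m, ∃ W Z : ObjectProperty (E i).heart.FullSubcategory, IsTilt (E i) (E (i + 1)) W Z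

end

end CategoryTheory.Triangulated.TStructure

namespace CategoryTheory

open Pretriangulated ZeroObject

/-! The type condition gives `D.ge 0 ≤ T.ge 0 ≤ D.ge (-n)`, so the co-aisles `D.ge (-i) ⊓ T.ge 0`
grow from that of `D` at `i = 0` to that of `T` at `i = n`. Each is contained in the next, and the
next in the shift of the first by one degree (`rightBasic_ge_le_succ`, `rightBasic_succ_ge_le`).
Such a gap of at most one forces an HRS tilt (`IsNonDegenerate.isTilt_of_ge_le_ge`): the
`E`-truncation triangle of an object of the heart of `D` stays in that heart, which yields the
torsion pair, and `E` can only cut inside one `D`-cohomology object, because the rest of the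
`D`-truncation triangle lies in the (co-)aisle of `E` automatically. Non-degeneracy lets vanishing
cohomology detect the aisles of `D`; it passes along the chain, whose members are at finite distance
from `D`. -/

/-- In a preadditive category with a zero object, a kernel-cokernel pair is a short exact
sequence. -/
theorem ShortComplex.shortExact_of_isLimit_of_isColimit {A : Type*} [Category* A] [Preadditive A]
    [HasZeroObject A] (S : ShortComplex A) (hf : IsLimit (KernelFork.ofι S.f S.zero))
    (hg : IsColimit (CokernelCofork.ofπ S.g S.zero)) : S.ShortExact := by
  -- The map from `S.X₁` to the cycles, again `S.X₁`, is the identity, so its cokernel, the left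
  -- homology, is `0`; dually on the right.
  have hlift : hf.lift (KernelFork.ofι _ S.zero) = 𝟙 _ :=
    Fork.IsLimit.hom_ext hf ((hf.fac _ WalkingParallelPair.zero).trans (Category.id_comp _).symm)
  have hdesc : hg.desc (CokernelCofork.ofπ _ S.zero) = 𝟙 _ :=
    Cofork.IsColimit.hom_ext hg
      ((hg.fac _ WalkingParallelPair.one).trans (Category.comp_id _).symm)
  have wπ : hf.lift (KernelFork.ofι _ S.zero) ≫ (0 : S.X₁ ⟶ (0 : A)) = 0 := comp_zero
  have wι : (0 : (0 : A) ⟶ S.X₃) ≫ hg.desc (CokernelCofork.ofπ _ S.zero) = 0 := zero_comp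
  have hepi : Epi (hf.lift (KernelFork.ofι _ S.zero)) := by rw [hlift]; infer_instance
  have hmono : Mono (hg.desc (CokernelCofork.ofπ _ S.zero)) := by rw [hdesc]; infer_instance
  let left : S.LeftHomologyData :=
    { K := S.X₁, H := 0, i := S.f, π := 0, wi := S.zero, hi := hf, wπ := wπ
      hπ := CokernelCofork.IsColimit.ofEpiOfIsZero (CokernelCofork.ofπ 0 wπ) hepi
        (isZero_zero A) }
  let right : S.RightHomologyData :=
    { Q := S.X₃, H := 0, p := S.g, ι := 0, wp := S.zero, hp := hg, wι := wι
      hι := KernelFork.IsLimit.ofMonoOfIsZero (KernelFork.ofι 0 wι) hmono (isZero_zero A) }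
  have hexact : S.Exact := ⟨{ left, right, iso := Iso.refl (0 : A), comm := by simp [left, right] },
    isZero_zero A⟩
  have : Mono S.f := ⟨fun _ _ h ↦ Fork.IsLimit.hom_ext hf h⟩
  have : Epi S.g := ⟨fun _ _ h ↦ Cofork.IsColimit.hom_ext hg h⟩
  exact ShortComplex.ShortExact.mk hexact

namespace Triangulated.TStructure

variable {C : Type u} [Category.{v} C] [Preadditive C] [HasZeroObject C] [HasShift C ℤ]
  [∀ n : ℤ, (shiftFunctor C n).Additive] [Pretriangulated C]

/-! ### Aisles and distinguished triangles -/

section Triangles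

variable (t : TStructure C) (T : Triangle C) (hT : T ∈ distTriang C) (n : ℤ)

include hT

/-- If `T` is distinguished, `T.obj₁` is `≤ n + 1` and `T.obj₂` is `≤ n`, then `T.obj₃` is
`≤ n`. -/
theorem isLE₃ (h₁ : t.IsLE T.obj₁ (n + 1)) (h₂ : t.IsLE T.obj₂ n) : t.IsLE T.obj₃ n :=
  t.isLE₂ T.rotate (rot_of_distTriang _ hT) n h₂ (t.isLE_shift T.obj₁ (n + 1) 1 n)

/-- If `T` is distinguished, `T.obj₂` is `≥ n` and `T.obj₃` is `≥ n - 1`, then `T.obj₁` is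
`≥ n`. -/
theorem isGE₁ (h₂ : t.IsGE T.obj₂ n) (h₃ : t.IsGE T.obj₃ (n - 1)) : t.IsGE T.obj₁ n :=
  t.isGE₂ T.invRotate (inv_rot_of_distTriang _ hT) n (t.isGE_shift T.obj₃ (n - 1) (-1) n) h₂

end Triangles

/-! ### Short exact sequences in the heart -/

section Heart

variable (t : TStructure C)

theorem isZero_heart_iff (M : t.heart.FullSubcategory) : IsZero M ↔ IsZero M.obj := by
  rw [IsZero.iff_id_eq_zero, IsZero.iff_id_eq_zero]
  exact ⟨fun h ↦ congrArg (fun f ↦ f.hom) h, fun h ↦ ObjectProperty.hom_ext _ h⟩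

theorem hasZeroObject_heart : HasZeroObject t.heart.FullSubcategory :=
  ⟨⟨0, (t.mem_heart_iff _).2 ⟨inferInstance, inferInstance⟩⟩,
    (t.isZero_heart_iff _).2 (isZero_zero C)⟩

instance (M : t.heart.FullSubcategory) : t.IsLE M.obj 0 := ((t.mem_heart_iff _).1 M.property).1

instance (M : t.heart.FullSubcategory) : t.IsGE M.obj 0 := ((t.mem_heart_iff _).1 M.property).2

/-- A distinguished triangle whose objects lie in the heart induces a short exact sequence in
the heart. -/
theorem shortExact_heart_of_distTriang (S : ShortComplex t.heart.FullSubcategory)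
    (h : S.X₃.obj ⟶ S.X₁.obj⟦(1 : ℤ)⟧)
    (hT : Triangle.mk S.f.hom S.g.hom h ∈ distTriang C) : S.ShortExact := by
  have := t.hasZeroObject_heart
  have : Mono S.f := by
    rw [Preadditive.mono_iff_cancel_zero]
    intro W k hk
    have hk' : k.hom ≫ S.f.hom = 0 := congrArg (fun f ↦ f.hom) hk
    -- A map killed by `S.f` factors through `S.X₃.obj⟦-1⟧`, which receives no nonzero map from the
    -- heart.
    have : t.IsGE (S.X₃.obj⟦(-1 : ℤ)⟧) 1 := t.isGE_shift _ 0 (-1) 1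
    obtain ⟨l, hl⟩ := Triangle.coyoneda_exact₂ _ (inv_rot_of_distTriang _ hT) k.hom hk'
    rw [show l = 0 from t.zero (Y := S.X₃.obj⟦(-1 : ℤ)⟧) l 0 1, zero_comp] at hl
    exact ObjectProperty.hom_ext _ hl
  have : Epi S.g := by
    rw [Preadditive.epi_iff_cancel_zero]
    intro W k hk
    have hk' : S.g.hom ≫ k.hom = 0 := congrArg (fun f ↦ f.hom) hk
    have : t.IsLE (S.X₁.obj⟦(1 : ℤ)⟧) (-1) := t.isLE_shift _ 0 1 (-1)
    obtain ⟨l, hl⟩ := Triangle.yoneda_exact₃ _ hT k.hom hk'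
    rw [show l = 0 from t.zero (X := S.X₁.obj⟦(1 : ℤ)⟧) l (-1) 0, comp_zero] at hl
    exact ObjectProperty.hom_ext _ hl
  have hlift : ∀ {W : t.heart.FullSubcategory} (k : W ⟶ S.X₂), k ≫ S.g = 0 →
      ∃ l : W ⟶ S.X₁, l ≫ S.f = k := fun k hk ↦ by
    obtain ⟨l, hl⟩ := Triangle.coyoneda_exact₂ _ hT k.hom (congrArg (fun f ↦ f.hom) hk)
    exact ⟨ObjectProperty.homMk l, ObjectProperty.hom_ext _ hl.symm⟩
  have hdesc : ∀ {W : t.heart.FullSubcategory} (k : S.X₂ ⟶ W), S.f ≫ k = 0 →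
      ∃ l : S.X₃ ⟶ W, S.g ≫ l = k := fun k hk ↦ by
    obtain ⟨l, hl⟩ := Triangle.yoneda_exact₂ _ hT k.hom (congrArg (fun f ↦ f.hom) hk)
    exact ⟨ObjectProperty.homMk l, ObjectProperty.hom_ext _ hl.symm⟩
  exact S.shortExact_of_isLimit_of_isColimit
    (KernelFork.IsLimit.ofι' _ _ fun k hk ↦ ⟨(hlift k hk).choose, (hlift k hk).choose_spec⟩)
    (CokernelCofork.IsColimit.ofπ' _ _ fun k hk ↦
      ⟨(hdesc k hk).choose, (hdesc k hk).choose_spec⟩)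

end Heart

/-! ### Comparing two t-structures by orthogonality and shifts -/

section Comparison

variable {D E : TStructure C}

theorem le_le_of_ge_le (m n : ℤ) (h : D.ge (m + 1) ≤ E.ge (n + 1)) : E.le n ≤ D.le m := by
  intro M hM
  rw [le_iff_isLE] at hM ⊢
  rw [D.isLE_iff_orthogonal m (m + 1) rfl]
  intro Y f hY
  have : E.IsGE Y (n + 1) := ⟨h _ hY.ge⟩
  exact E.zero f n (n + 1)

theorem ge_le_of_le_le (m n : ℤ) (h : D.le m ≤ E.le n) : E.ge (n + 1) ≤ D.ge (m + 1) := by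
  intro M hM
  rw [ge_iff_isGE] at hM ⊢
  rw [D.isGE_iff_orthogonal m (m + 1) rfl]
  intro Y f hY
  have : E.IsLE Y n := ⟨h _ hY.le⟩
  exact E.zero f n (n + 1)

theorem ge_le_ge_of_shift {a b : ℤ} (h : D.ge a ≤ E.ge b) (c a' b' : ℤ) (ha : a + c = a')
    (hb : b + c = b') : D.ge a' ≤ E.ge b' := by
  intro M hM
  rw [ge_iff_isGE] at hM ⊢
  have := D.isGE_shift M a' c a (by lia)
  have : E.IsGE (M⟦c⟧) b := ⟨h _ this.ge⟩
  exact E.isGE_of_shift M b' c b (by lia)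

/-- Non-degeneracy passes to a t-structure at finite distance. -/
theorem IsNonDegenerate.of_ge_le_ge (hD : D.IsNonDegenerate) (m : ℤ)
    (h₁ : D.ge 0 ≤ E.ge 0) (h₂ : E.ge 0 ≤ D.ge m) : E.IsNonDegenerate where
  isZero_of_forall_le M hM := hD.isZero_of_forall_le M fun n ↦
    le_le_of_ge_le n n (ge_le_ge_of_shift h₁ (n + 1) _ _ (by lia) (by lia)) M (hM n)
  isZero_of_forall_ge M hM := hD.isZero_of_forall_ge M fun n ↦
    ge_le_ge_of_shift h₂ (n - m) (n - m) n (by lia) (by lia) M (hM (n - m))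

end Comparison

/-! ### Detecting aisles by cohomology -/

section Cohomology

variable [IsTriangulated C] (t : TStructure C)

theorem isZero_cohomology_of_isLE (M : C) (n i : ℤ) (h : n < i) [t.IsLE M n] :
    IsZero (t.cohomology i M) := by
  rw [isZero_heart_iff]
  have := t.isLE_shift M n i (n - i)
  have := t.isLE_of_le (M⟦i⟧) (n - i) (-1)
  exact t.isZero_truncGE_obj_of_isLE (-1) 0 (by lia) ((t.truncLE 0).obj (M⟦i⟧))

theorem isZero_cohomology_of_isGE (M : C) (n i : ℤ) (h : i < n) [t.IsGE M n] :
    IsZero (t.cohomology i M) := by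
  rw [isZero_heart_iff]
  have := t.isGE_shift M n i (n - i)
  have := t.isGE_of_ge (M⟦i⟧) 1 (n - i)
  exact (t.truncGE 0).map_isZero (t.isZero_truncLE_obj_of_isGE 0 1 (by lia) (M⟦i⟧))

/-- The cohomology in the top degree is a truncation. -/
noncomputable def cohomologyIsoTruncGE (M : C) (i : ℤ) [t.IsLE M i] :
    (t.cohomology i M).obj ≅ (t.truncGE 0).obj (M⟦i⟧) :=
  have := t.isLE_shift M i i 0
  (t.truncGE 0).mapIso (asIso ((t.truncLEι 0).app (M⟦i⟧)))

/-- The cohomology in the bottom degree is a truncation. -/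
noncomputable def cohomologyIsoTruncLE (M : C) (i : ℤ) [t.IsGE M i] :
    (t.cohomology i M).obj ≅ (t.truncLE 0).obj (M⟦i⟧) :=
  have := t.isGE_shift M i i 0
  (asIso ((t.truncGEπ 0).app ((t.truncLE 0).obj (M⟦i⟧)))).symm

theorem isZero_cohomology_iff_of_isLE₁ (T : Triangle C) (hT : T ∈ distTriang C) (n i : ℤ)
    (h : n < i) (h₁ : t.IsLE T.obj₁ n) :
    IsZero (t.cohomology i T.obj₂) ↔ IsZero (t.cohomology i T.obj₃) := by
  rw [isZero_heart_iff, isZero_heart_iff]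
  have := t.isLE_shift T.obj₁ n i (n - i)
  have := t.isIso₂_truncGE_map_of_isLE _ (Triangle.shift_distinguished T hT i) (-1) 0 (by lia)
    (t.isLE_of_le (T.obj₁⟦i⟧) (n - i) (-1))
  -- The truncations are commuted because `truncGE`, not `truncLE`, inverts the second map of the
  -- triangle.
  exact ((t.truncGELEIsoLEGE 0 0).app _ ≪≫
    (t.truncLE 0).mapIso (@asIso _ _ _ _ _ this) ≪≫
    ((t.truncGELEIsoLEGE 0 0).app _).symm).isZero_iff

theorem isZero_cohomology_iff_of_isGE₃ (T : Triangle C) (hT : T ∈ distTriang C) (n i : ℤ)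
    (h : i < n) (h₃ : t.IsGE T.obj₃ n) :
    IsZero (t.cohomology i T.obj₁) ↔ IsZero (t.cohomology i T.obj₂) := by
  rw [isZero_heart_iff, isZero_heart_iff]
  have := t.isGE_shift T.obj₃ n i (n - i)
  have := t.isIso₁_truncLE_map_of_isGE _ (Triangle.shift_distinguished T hT i) 0 1 (by lia)
    (t.isGE_of_ge (T.obj₃⟦i⟧) 1 (n - i))
  exact ((t.truncGE 0).mapIso (@asIso _ _ _ _ _ this)).isZero_iff

theorem isGE_succ_of_isZero_cohomology (M : C) (n : ℤ) [t.IsGE M n]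
    (h : IsZero (t.cohomology n M)) : t.IsGE M (n + 1) := by
  have := t.isGE_shift M n n 0
  have : t.IsGE (M⟦n⟧) 1 := (t.isGE_iff_isZero_truncLE_obj 0 1 (by lia) _).2
    ((t.cohomologyIsoTruncLE M n).isZero_iff.1 ((t.isZero_heart_iff _).1 h))
  exact t.isGE_of_shift M (n + 1) n 1

theorem isLE_pred_of_isZero_cohomology (M : C) (n : ℤ) [t.IsLE M n]
    (h : IsZero (t.cohomology n M)) : t.IsLE M (n - 1) := by
  have : t.IsLE (M⟦n⟧) (-1) := (t.isLE_iff_isZero_truncGE_obj (-1) 0 (by lia) _).2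
    ((t.cohomologyIsoTruncGE M n).isZero_iff.1 ((t.isZero_heart_iff _).1 h))
  exact t.isLE_of_shift M (n - 1) n (-1)

variable {t}

/-- For a non-degenerate t-structure, the aisles are detected by cohomology. -/
theorem IsNonDegenerate.isLE_iff (ht : t.IsNonDegenerate) (M : C) (n : ℤ) :
    t.IsLE M n ↔ ∀ i, n < i → IsZero (t.cohomology i M) := by
  refine ⟨fun _ i hi ↦ t.isZero_cohomology_of_isLE M n i hi, fun h ↦ ?_⟩
  rw [t.isLE_iff_isZero_truncGE_obj n (n + 1) rfl]
  -- The truncation `≥ n + 1` has no cohomology left, so its lower bound can be raised forever;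
  -- non-degeneracy then kills it.
  have key : ∀ k : ℕ, t.IsGE ((t.truncGE (n + 1)).obj M) (n + 1 + k) := by
    intro k
    induction k with
    | zero => simpa using (inferInstance : t.IsGE ((t.truncGE (n + 1)).obj M) (n + 1))
    | succ k ih =>
      have := t.isGE_succ_of_isZero_cohomology ((t.truncGE (n + 1)).obj M) (n + 1 + k)
        ((t.isZero_cohomology_iff_of_isLE₁ _ (t.triangleLEGE_distinguished n (n + 1) rfl M) n _
          (by lia) (t.isLE_truncLE_obj M n n)).1 (h _ (by lia)))
      exact t.isGE_of_ge _ _ (n + 1 + k + 1) (by push_cast; lia)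
  refine ht.isZero_of_forall_ge _ fun m ↦ ?_
  have := key (m - n).toNat
  exact (t.isGE_of_ge _ m (n + 1 + (m - n).toNat)).ge

/-- For a non-degenerate t-structure, the co-aisles are detected by cohomology. -/
theorem IsNonDegenerate.isGE_iff (ht : t.IsNonDegenerate) (M : C) (n : ℤ) :
    t.IsGE M n ↔ ∀ i, i < n → IsZero (t.cohomology i M) := by
  refine ⟨fun _ i hi ↦ t.isZero_cohomology_of_isGE M n i hi, fun h ↦ ?_⟩
  rw [t.isGE_iff_isZero_truncLE_obj (n - 1) n (by lia)]
  have key : ∀ k : ℕ, t.IsLE ((t.truncLE (n - 1)).obj M) (n - 1 - k) := by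
    intro k
    induction k with
    | zero => simpa using (inferInstance : t.IsLE ((t.truncLE (n - 1)).obj M) (n - 1))
    | succ k ih =>
      have := t.isLE_pred_of_isZero_cohomology ((t.truncLE (n - 1)).obj M) (n - 1 - k)
        ((t.isZero_cohomology_iff_of_isGE₃ _
          (t.triangleLEGE_distinguished (n - 1) n (by lia) M) n _
          (by lia) (t.isGE_truncGE_obj M n n)).2 (h _ (by lia)))
      exact t.isLE_of_le _ (n - 1 - k - 1) _ (by push_cast; lia)
  refine ht.isZero_of_forall_le _ fun m ↦ ?_
  have := key (n - m).toNat
  exact (t.isLE_of_le _ (n - 1 - (n - m).toNat) m).le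

end Cohomology

/-! ### A gap of one is an HRS tilt -/

section Tilt

variable {D E : TStructure C}

/-- If `D^{≥ 0} ⊆ E^{≥ 0} ⊆ D^{≥ -1}`, then the aisle and the co-aisle of `E` cut out a torsion
pair in the heart of `D`. -/
theorem isTorsionPair_of_ge_le_ge (h₁ : D.ge 0 ≤ E.ge 0) (h₂ : E.ge 0 ≤ D.ge (-1)) :
    IsTorsionPair ((E.le 0).inverseImage D.heart.ι) ((E.ge 1).inverseImage D.heart.ι) where
  isoClosed_left := inferInstance
  isoClosed_right := inferInstance
  hom_eq_zero _ _ hM hN f := ObjectProperty.hom_ext _ (E.zero' f.hom hM hN)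
  exists_shortExact A := by
    obtain ⟨U, V, hU, hV, f, g, h, hT⟩ := E.exists_triangle_zero_one A.obj
    have hU' : D.IsLE U 0 :=
      ⟨le_le_of_ge_le 0 0 (ge_le_ge_of_shift h₁ 1 _ _ (by lia) (by lia)) _ hU⟩
    have hV' : D.IsGE V 0 := ⟨ge_le_ge_of_shift h₂ 1 _ _ (by lia) (by lia) _ hV⟩
    have hU'' : D.IsGE U 0 := D.isGE₁ _ hT 0 (inferInstanceAs (D.IsGE A.obj 0))
      (D.isGE_of_ge V _ 0)
    have hV'' : D.IsLE V 0 := D.isLE₃ _ hT 0 (D.isLE_of_le U 0 _)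
      (inferInstanceAs (D.IsLE A.obj 0))
    let X : D.heart.FullSubcategory := ⟨U, (D.mem_heart_iff _).2 ⟨hU', hU''⟩⟩
    let Y : D.heart.FullSubcategory := ⟨V, (D.mem_heart_iff _).2 ⟨hV'', hV'⟩⟩
    let S : ShortComplex D.heart.FullSubcategory :=
      ShortComplex.mk (X₁ := X) (X₂ := A) (X₃ := Y) (ObjectProperty.homMk f)
        (ObjectProperty.homMk g) (ObjectProperty.hom_ext _ (comp_distTriang_mor_zero₁₂ _ hT))
    exact ⟨S, D.shortExact_heart_of_distTriang S h hT, hU, rfl, hV⟩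

variable [IsTriangulated C]

/-- If `D` is non-degenerate and `D^{≥ 0} ⊆ E^{≥ 0} ⊆ D^{≥ -1}`, then `E` is a
Happel-Reiten-Smalø tilt of `D`. -/
theorem IsNonDegenerate.isTilt_of_ge_le_ge (hD : D.IsNonDegenerate) (h₁ : D.ge 0 ≤ E.ge 0)
    (h₂ : E.ge 0 ≤ D.ge (-1)) :
    IsTilt D E ((E.le 0).inverseImage D.heart.ι) ((E.ge 1).inverseImage D.heart.ι) where
  isTorsionPair := isTorsionPair_of_ge_le_ge h₁ h₂
  le_zero_iff M := by
    have hle : E.le 0 ≤ D.le 0 :=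
      le_le_of_ge_le 0 0 (ge_le_ge_of_shift h₁ 1 _ _ (by lia) (by lia))
    have hle' : D.le (-1) ≤ E.le 0 :=
      le_le_of_ge_le 0 (-1) (ge_le_ge_of_shift h₂ 1 _ _ (by lia) (by lia))
    have key (hM : D.IsLE M 0) :
        E.IsLE M 0 ↔ E.IsLE (D.cohomology 0 M).obj 0 := by
      have := D.isLE_shift M 0 0 0
      let N := M⟦(0 : ℤ)⟧
      -- The part of `N` in `D.le (-1)` is already in `E.le 0`, so only the top cohomology matters.
      have hN₁ : E.IsLE ((D.truncLE (-1)).obj N) 0 :=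
        ⟨hle' _ (D.isLE_truncLE_obj N (-1) (-1)).le⟩
      have hN := D.triangleLEGE_distinguished (-1) 0 (by lia) N
      rw [← E.isLE_shift_iff M 0 0 0]
      trans E.IsLE ((D.truncGE 0).obj N) 0
      · exact ⟨fun h ↦ E.isLE₃ _ hN 0 (E.isLE_of_le ((D.truncLE (-1)).obj N) 0 _) h,
          fun h ↦ E.isLE₂ _ hN 0 hN₁ h⟩
      · rw [← le_iff_isLE, ← le_iff_isLE]
        exact (E.le 0).prop_iff_of_iso (D.cohomologyIsoTruncGE M 0).symm
    rw [← hD.isLE_iff M 0, le_iff_isLE]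
    change _ ↔ E.le 0 (D.cohomology 0 M).obj ∧ _
    rw [le_iff_isLE]
    refine ⟨fun h ↦ ?_, fun h ↦ (key h.2).2 h.1⟩
    have hM : D.IsLE M 0 := ⟨hle _ h.le⟩
    exact ⟨(key hM).1 h, hM⟩
  ge_zero_iff M := by
    have hge : D.ge 1 ≤ E.ge 1 := ge_le_ge_of_shift h₁ 1 _ _ (by lia) (by lia)
    have key (hM : D.IsGE M (-1)) :
        E.IsGE M 0 ↔ E.IsGE (D.cohomology (-1) M).obj 1 := by
      have := D.isGE_shift M (-1) (-1) 0
      let N := M⟦(-1 : ℤ)⟧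
      have hN₃ : E.IsGE ((D.truncGE 1).obj N) 1 := ⟨hge _ (D.isGE_truncGE_obj N 1 1).ge⟩
      have hN := D.triangleLEGE_distinguished 0 1 (by lia) N
      -- Degree `-1` cohomology truncates `M⟦-1⟧`, so `E.ge 0` for `M` becomes `E.ge 1`, the
      -- torsion-free condition.
      rw [← E.isGE_shift_iff M 0 (-1) 1]
      trans E.IsGE ((D.truncLE 0).obj N) 1
      · exact ⟨fun h ↦ E.isGE₁ _ hN 1 h (E.isGE_of_ge ((D.truncGE 1).obj N) _ 1),
          fun h ↦ E.isGE₂ _ hN 1 h hN₃⟩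
      · rw [← ge_iff_isGE, ← ge_iff_isGE]
        exact (E.ge 1).prop_iff_of_iso (D.cohomologyIsoTruncLE M (-1)).symm
    rw [← hD.isGE_iff M (-1), ge_iff_isGE]
    change _ ↔ E.ge 1 (D.cohomology (-1) M).obj ∧ _
    rw [ge_iff_isGE]
    refine ⟨fun h ↦ ?_, fun h ↦ (key h.2).2 h.1⟩
    have hM : D.IsGE M (-1) := ⟨h₂ _ h.ge⟩
    exact ⟨(key hM).1 h, hM⟩

end Tilt

/-! ### The chain of right basic t-structures -/

section RightBasic

variable {D T : TStructure C} (h : IsRightFilterable D T)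

theorem rightBasic_eq_left (hDT : D.ge 0 ≤ T.ge 0) : rightBasic h 0 = D :=
  eq_of_ge_zero_eq _ _ (by rw [rightBasic_ge_zero, neg_zero, inf_eq_left.2 hDT])

theorem rightBasic_eq_right (i : ℤ) (hTD : T.ge 0 ≤ D.ge (-i)) : rightBasic h i = T :=
  eq_of_ge_zero_eq _ _ (by rw [rightBasic_ge_zero, inf_eq_right.2 hTD])

theorem rightBasic_ge_le_succ (i : ℤ) : (rightBasic h i).ge 0 ≤ (rightBasic h (i + 1)).ge 0 := by
  rw [rightBasic_ge_zero, rightBasic_ge_zero]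
  exact inf_le_inf_right _ (D.ge_antitone (by lia))

/-- The shift by `-1` raises both lower bounds by one: `D.ge (-(i + 1))` moves into `D.ge (-i)`,
while `T.ge 0` moves into `T.ge 1 ≤ T.ge 0`. -/
theorem rightBasic_succ_ge_le (i : ℤ) :
    (rightBasic h (i + 1)).ge 0 ≤ (rightBasic h i).ge (-1) := by
  intro M hM
  rw [rightBasic_ge_zero] at hM
  have : D.IsGE M (-(i + 1)) := ⟨hM.1⟩
  have : T.IsGE M 0 := ⟨hM.2⟩
  have := D.isGE_shift M (-(i + 1)) (-1) (-i)
  have := T.isGE_shift M 0 (-1) 1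
  have := T.isGE_of_ge (M⟦(-1 : ℤ)⟧) 0 1
  have hM' : (rightBasic h i).IsGE (M⟦(-1 : ℤ)⟧) 0 :=
    ⟨by rw [rightBasic_ge_zero]; exact ⟨D.ge_of_isGE _ _, T.ge_of_isGE _ _⟩⟩
  exact ((rightBasic h i).isGE_of_shift M (-1) (-1) 0).ge

theorem rightBasic_isNonDegenerate (hD : D.IsNonDegenerate) (hDT : D.ge 0 ≤ T.ge 0) (i : ℤ)
    (hi : 0 ≤ i) : (rightBasic h i).IsNonDegenerate := by
  refine hD.of_ge_le_ge (-i) ?_ ?_ <;> rw [rightBasic_ge_zero]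
  · exact le_inf (D.ge_antitone (by lia)) hDT
  · exact inf_le_left

end RightBasic

end Triangulated.TStructure

end CategoryTheory

theorem mainTheorem1 {C : Type u} [Category.{v} C] [Preadditive C] [HasZeroObject C]
    [HasShift C ℤ] [∀ n : ℤ, (shiftFunctor C n).Additive] [Pretriangulated C] [IsTriangulated C]
    (D T : TStructure C) (hD : D.IsNonDegenerate) (n : ℕ)
    (hfilt : TStructure.IsRightFilterable D T) (htype : TStructure.IsOfType D T n 0) :
    TStructure.IsIteratedHRS D T n ∧
    TStructure.rightBasic hfilt 0 = D ∧
    TStructure.rightBasic hfilt n = T ∧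
    (∀ i : ℕ, i ≤ n →
      (TStructure.rightBasic hfilt i).ge 0 = D.ge (-(i : ℤ)) ⊓ T.ge 0 ∧
      (TStructure.rightBasic hfilt i).IsNonDegenerate) ∧
    (∀ i : ℕ, i < n →
      TStructure.IsTilt (TStructure.rightBasic hfilt i) (TStructure.rightBasic hfilt (i + 1))
        (TStructure.rightBasicTorsion hfilt i) (TStructure.rightBasicTorsionFree hfilt i)) := by
  -- Orthogonality reverses the aisle inclusions but lands one degree too high, hence the shift by
  -- `-1`.
  have hDT : D.ge 0 ≤ T.ge 0 :=
    TStructure.ge_le_ge_of_shift (TStructure.ge_le_of_le_le 0 0 htype.1.1) (-1) _ _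
      (by lia) (by lia)
  have hTD : T.ge 0 ≤ D.ge (-(n : ℤ)) :=
    TStructure.ge_le_ge_of_shift (TStructure.ge_le_of_le_le _ 0 htype.2.1) (-1) _ _
      (by lia) (by lia)
  have h₀ := TStructure.rightBasic_eq_left hfilt hDT
  have hₙ := TStructure.rightBasic_eq_right hfilt n hTD
  have hnd (i : ℕ) := TStructure.rightBasic_isNonDegenerate hfilt hD hDT i (by lia)
  have htilt (i : ℕ) := (hnd i).isTilt_of_ge_le_ge
    (TStructure.rightBasic_ge_le_succ hfilt i) (TStructure.rightBasic_succ_ge_le hfilt i)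
  refine ⟨⟨fun i ↦ TStructure.rightBasic hfilt i, by simpa using h₀, hₙ, fun i _ ↦ hnd i,
    fun i _ ↦
      ⟨TStructure.rightBasicTorsion hfilt i, TStructure.rightBasicTorsionFree hfilt i, ?_⟩⟩, h₀, hₙ,
    fun i _ ↦ ⟨TStructure.rightBasic_ge_zero hfilt i, hnd i⟩, fun i _ ↦ htilt i⟩
  push_cast
  exact htilt i
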